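/- Let $T$ be a finite simple graph. The eigenvalues of $T$ are those of its adjacency matrix $A$; an eigenvalue of $T$ is called main if it has an eigenvector that is not orthogonal to the all-ones vector, and non-main otherwise. For integers $k,s\ge 1$ let $T(k,s)$ be the graph on $k+s+2$ vertices consisting of two adjacent vertices, of which one is joined to $k$ further pendant vertices and the other to $s$ further pendant vertices. A double star is a tree of diameter three; equivalently, a graph isomorphic to $T(k,s)$ for some $k,s\ge 1$, and it is called balanced if $k=s$. Theorem. $T$ is a tree of diameter $3$ if and only if $T\cong T(k,s)$ for some integers $k,s\ge 1$. Moreover, for all integers $k,s\ge1$ with $T\cong T(k,s)$: 1. the least eigenvalue of $T$ is non-main if and only if $k=s$; 2. if $k\ne s$, then $T$ has exactly four nonzero eigenvalues, each of them has multiplicity one, and all four are main. -/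

import Mathlib

/-- `μ` is an eigenvalue of the graph `G`: a (real) eigenvalue of its adjacency matrix. -/
def IsGraphEigenvalue {V : Type*} [Fintype V] [DecidableEq V] (G : SimpleGraph V)
    [DecidableRel G.Adj] (μ : ℝ) : Prop :=
  Module.End.HasEigenvalue (Matrix.toLin' (G.adjMatrix ℝ)) μ

/-- `μ` is a main eigenvalue of `G`: some eigenvector of the adjacency matrix for `μ`
is not orthogonal to the all-ones vector. -/
def IsMainEigenvalue {V : Type*} [Fintype V] [DecidableEq V] (G : SimpleGraph V)
    [DecidableRel G.Adj] (μ : ℝ) : Prop :=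
  ∃ x : V → ℝ, Module.End.HasEigenvector (Matrix.toLin' (G.adjMatrix ℝ)) μ x ∧
    x ⬝ᵥ (fun _ => (1 : ℝ)) ≠ 0

/-- `μ` is a non-main eigenvalue of `G`: an eigenvalue that is not main. -/
def IsNonMainEigenvalue {V : Type*} [Fintype V] [DecidableEq V] (G : SimpleGraph V)
    [DecidableRel G.Adj] (μ : ℝ) : Prop :=
  IsGraphEigenvalue G μ ∧ ¬ IsMainEigenvalue G μ

/-- The graph `T(k,s)`: two adjacent centres `0` and `1`, with `k` pendant vertices attached to
the centre `0` and `s` pendant vertices attached to the centre `1`.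
(`SimpleGraph.fromRel` symmetrises the relation.) -/
def doubleStar (k s : ℕ) : SimpleGraph (Fin 2 ⊕ Fin k ⊕ Fin s) :=
  SimpleGraph.fromRel fun u v =>
    match u, v with
    | .inl a, .inl b => a ≠ b
    | .inl a, .inr (.inl _) => a = 0
    | .inl a, .inr (.inr _) => a = 1
    | _, _ => False

/-! In a tree of diameter three take a path u, a, b, v of length three. Relative to any root, a
vertex of a tree has at most one neighbour nearer to the root, so a vertex w outside {a, b} and not
adjacent to either would be at distance at least 4 from u or v. Hence everything hangs from a or b.

For μ ≠ 0, the equations at the leaves make an eigenvector constant on each leaf class, say a and b,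
with μa and μb on the centres. The equations at the centres become (μ² - k)a = μb and (μ² - s)b =
μa. So each nonzero eigenvalue is simple, and μ² is a root of (t - k)(t - s) = t, which has two
distinct positive roots. The entries sum to μ²(a + b), which vanishes only if b = -a, and this
forces k = s. Conversely, if k = s, the least eigenvalue satisfies μ² - k = -μ, which forces b = -a.
-/

open SimpleGraph

/-! ### Adjacency in the double star. -/

section Adjacency

variable {k s : ℕ}

@[simp] lemma doubleStar_adj_centre_centre (a b : Fin 2) :
    (doubleStar k s).Adj (.inl a) (.inl b) ↔ a ≠ b := by
  simp only [doubleStar, fromRel_adj, ne_eq, Sum.inl.injEq]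
  tauto

@[simp] lemma doubleStar_adj_centre_left (a : Fin 2) (i : Fin k) :
    (doubleStar k s).Adj (.inl a) (.inr (.inl i)) ↔ a = 0 := by
  simp [doubleStar]

@[simp] lemma doubleStar_adj_centre_right (a : Fin 2) (j : Fin s) :
    (doubleStar k s).Adj (.inl a) (.inr (.inr j)) ↔ a = 1 := by
  simp [doubleStar]

@[simp] lemma doubleStar_adj_left_centre (a : Fin 2) (i : Fin k) :
    (doubleStar k s).Adj (.inr (.inl i)) (.inl a) ↔ a = 0 := by
  simp [doubleStar]

@[simp] lemma doubleStar_adj_right_centre (a : Fin 2) (j : Fin s) :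
    (doubleStar k s).Adj (.inr (.inr j)) (.inl a) ↔ a = 1 := by
  simp [doubleStar]

@[simp] lemma not_doubleStar_adj_inr_inr (p q : Fin k ⊕ Fin s) :
    ¬ (doubleStar k s).Adj (.inr p) (.inr q) := by
  simp [doubleStar]

end Adjacency

/-! ### Double stars are trees of diameter three. -/

section Distance

lemma exists_walk_doubleStar_centre {k s : ℕ} (u : Fin 2 ⊕ Fin k ⊕ Fin s) :
    ∃ (c : Fin 2) (p : (doubleStar k s).Walk u (.inl c)), p.length ≤ 1 := by
  rcases u with a | i | j
  · exact ⟨a, .nil, by simp⟩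
  · exact ⟨0, .cons (by simp) .nil, by simp⟩
  · exact ⟨1, .cons (by simp) .nil, by simp⟩

lemma exists_walk_doubleStar {k s : ℕ} (u v : Fin 2 ⊕ Fin k ⊕ Fin s) :
    ∃ p : (doubleStar k s).Walk u v, p.length ≤ 3 := by
  obtain ⟨c, p, hp⟩ := exists_walk_doubleStar_centre u
  obtain ⟨d, q, hq⟩ := exists_walk_doubleStar_centre v
  have hc : ∀ a b : Fin 2, ∃ w : (doubleStar k s).Walk (.inl a) (.inl b), w.length ≤ 1 := by
    intro a b
    by_cases h : a = b
    · subst h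
      exact ⟨.nil, by simp⟩
    · exact ⟨.cons (by simpa using h) .nil, by simp⟩
  obtain ⟨w, hw⟩ := hc c d
  refine ⟨p.append (w.append q.reverse), ?_⟩
  simp only [Walk.length_append, Walk.length_reverse]
  omega

lemma doubleStar_connected (k s : ℕ) : (doubleStar k s).Connected where
  preconnected u v := ⟨(exists_walk_doubleStar u v).choose⟩
  nonempty := ⟨.inl 0⟩

lemma doubleStar_isTree (k s : ℕ) : (doubleStar k s).IsTree := by
  rw [isTree_iff_connected_and_card]
  refine ⟨doubleStar_connected k s, le_antisymm ?_
    (doubleStar_connected k s).card_vert_le_card_edgeSet_add_one⟩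
  -- `g` lists every edge, so there are at most k + s + 1 of them.
  let g : Fin 1 ⊕ Fin k ⊕ Fin s → Sym2 (Fin 2 ⊕ Fin k ⊕ Fin s)
    | .inl _ => s(.inl 0, .inl 1)
    | .inr (.inl i) => s(.inl 0, .inr (.inl i))
    | .inr (.inr j) => s(.inl 1, .inr (.inr j))
  have hsub : (doubleStar k s).edgeSet ⊆ Set.range g := by
    intro e
    induction e with
    | h u v =>
      rw [mem_edgeSet]
      intro h
      rcases u with a | i | j <;> rcases v with b | i' | j' <;> simp at h
      · refine ⟨.inl 0, ?_⟩
        fin_cases a <;> fin_cases b <;> simp [g] at h ⊢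
      · exact ⟨.inr (.inl i'), by simp [g, h]⟩
      · exact ⟨.inr (.inr j'), by simp [g, h]⟩
      · exact ⟨.inr (.inl i), by simp [g, h]⟩
      · exact ⟨.inr (.inr j), by simp [g, h]⟩
  have h1 : Nat.card (doubleStar k s).edgeSet ≤ Nat.card (Set.range g) :=
    Nat.card_mono (Set.toFinite _) hsub
  have h2 : Nat.card (Set.range g) ≤ Nat.card (Fin 1 ⊕ Fin k ⊕ Fin s) :=
    Finite.card_range_le g
  simp only [Nat.card_eq_fintype_card, Fintype.card_sum, Fintype.card_fin] at h1 h2 ⊢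
  omega

lemma SimpleGraph.Walk.le_add_length_of_lipschitz {W : Type*} {G : SimpleGraph W} (f : W → ℕ)
    (hf : ∀ u v, G.Adj u v → f v ≤ f u + 1) {u v : W} (p : G.Walk u v) :
    f v ≤ f u + p.length := by
  induction p with
  | nil => simp
  | cons h p ih =>
    have := hf _ _ h
    rw [Walk.length_cons]
    omega

lemma three_le_length_doubleStar {k s : ℕ} {i : Fin k} {j : Fin s}
    (p : (doubleStar k s).Walk (.inr (.inl i)) (.inr (.inr j))) : 3 ≤ p.length := by
  -- A potential increasing by at most one along each edge: 0 and 3 on the two leaf classes, 1 and 2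
  -- on the centres.
  let f : Fin 2 ⊕ Fin k ⊕ Fin s → ℕ
    | .inl a => a + 1
    | .inr (.inl _) => 0
    | .inr (.inr _) => 3
  have := p.le_add_length_of_lipschitz f (by
    rintro (a | i | j) (b | i' | j') h <;> simp at h <;> simp [f] <;> omega)
  simpa [f] using this

lemma diam_eq_of_dist {W : Type*} [Finite W] {G : SimpleGraph W} (hG : G.Connected) {n : ℕ}
    (hle : ∀ u v, G.dist u v ≤ n) (hex : ∃ u v, n ≤ G.dist u v) : G.diam = n := by
  have := hG.nonempty
  obtain ⟨u, v, h⟩ := G.exists_dist_eq_diam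
  obtain ⟨u', v', h'⟩ := hex
  exact le_antisymm (h ▸ hle u v) (h'.trans (dist_le_diam (connected_iff_ediam_ne_top.1 hG)))

lemma isTree_and_diam_eq_three_of_iso {V : Type*} [Finite V] {T : SimpleGraph V} {k s : ℕ}
    (hk : 1 ≤ k) (hs : 1 ≤ s) (e : T ≃g doubleStar k s) : T.IsTree ∧ T.diam = 3 := by
  have hT : T.IsTree := e.isTree_iff.2 (doubleStar_isTree k s)
  refine ⟨hT, diam_eq_of_dist hT.connected (fun u v => ?_) ?_⟩
  · obtain ⟨p, hp⟩ := exists_walk_doubleStar (e u) (e v)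
    have := dist_le ((p.map e.symm.toHom).copy (e.symm_apply_apply u) (e.symm_apply_apply v))
    simp only [Walk.length_copy, Walk.length_map] at this
    omega
  · refine ⟨e.symm (.inr (.inl ⟨0, hk⟩)), e.symm (.inr (.inr ⟨0, hs⟩)), ?_⟩
    obtain ⟨p, hp⟩ := hT.connected.exists_walk_length_eq_dist
      (e.symm (.inr (.inl ⟨0, hk⟩))) (e.symm (.inr (.inr ⟨0, hs⟩)))
    rw [← hp]
    have := three_le_length_doubleStar
      ((p.map e.toHom).copy (e.apply_symm_apply _) (e.apply_symm_apply _))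
    simpa using this

end Distance

/-! ### Trees of diameter three are double stars. -/

section Trees

variable {V : Type*} {T : SimpleGraph V}

/-- In a tree, a vertex has at most one neighbour that is closer to a given root. -/
lemma SimpleGraph.IsTree.eq_of_adj_of_dist (hT : T.IsTree) {x v p q : V} (hp : T.Adj p v)
    (hq : T.Adj q v) (hpd : T.dist x v = T.dist x p + 1) (hqd : T.dist x v = T.dist x q + 1) :
    p = q := by
  obtain ⟨P, hP⟩ := hT.connected.exists_walk_length_eq_dist x p
  obtain ⟨Q, hQ⟩ := hT.connected.exists_walk_length_eq_dist x q
  -- Both extended walks to v are shortest, hence paths; uniqueness of paths in a tree identifies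
  -- their penultimate vertices.
  have hP' : (P.concat hp).IsPath := Walk.isPath_of_length_eq_dist _ (by simp [hP, hpd])
  have hQ' : (Q.concat hq).IsPath := Walk.isPath_of_length_eq_dist _ (by simp [hQ, hqd])
  have h := (hT.existsUnique_path x v).unique hP' hQ'
  have := congrArg Walk.penultimate h
  simpa using this

/-- If `w` is closer to `a` than to its neighbour `b`, then every other neighbour of `b` is even
further away. -/
lemma SimpleGraph.IsTree.dist_eq_add_two (hT : T.IsTree) {w a b v : V} (hab : T.Adj a b)
    (hbv : T.Adj b v) (hav : a ≠ v) (h : T.dist w b = T.dist w a + 1) :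
    T.dist w v = T.dist w a + 2 := by
  rcases hT.dist_eq_dist_add_one_of_adj w hbv with h' | h'
  · exact absurd (hT.eq_of_adj_of_dist hab hbv.symm h h') hav
  · omega

/-- If w is nearer to a than to b, then v lies two steps beyond a; the bound 3 leaves distance 1
from w to a. The other case is symmetric, with u in place of v. -/
lemma SimpleGraph.IsTree.adj_or_adj_of_dist_le_three (hT : T.IsTree)
    (hd : ∀ u v, T.dist u v ≤ 3) {u a b v : V} (hua : T.Adj u a) (hab : T.Adj a b)
    (hbv : T.Adj b v) (hub : u ≠ b) (hav : a ≠ v) {w : V} (hwa : w ≠ a) (hwb : w ≠ b) :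
    T.Adj a w ∨ T.Adj b w := by
  have ha := hT.connected.pos_dist_of_ne hwa
  have hb := hT.connected.pos_dist_of_ne hwb
  rcases hT.dist_eq_dist_add_one_of_adj w hab with h | h
  · have := hT.dist_eq_add_two hab.symm hua.symm hub.symm h
    have := hd w u
    exact .inr (dist_eq_one_iff_adj.1 (by omega)).symm
  · have := hT.dist_eq_add_two hab hbv hav h
    have := hd w v
    exact .inl (dist_eq_one_iff_adj.1 (by omega)).symm

/-- Adjacent vertices of a tree have different distances from a. -/
lemma SimpleGraph.IsTree.not_adj_of_adj_of_adj (hT : T.IsTree) {a w w' : V} (h : T.Adj a w)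
    (h' : T.Adj a w') : ¬ T.Adj w w' := fun hw =>
  hT.dist_ne_of_adj a hw ((dist_eq_one_iff_adj.2 h).trans (dist_eq_one_iff_adj.2 h').symm)

/-- Otherwise b and w would be two neighbours of w' nearer to a. -/
lemma SimpleGraph.IsTree.not_adj_of_adj_of_adj_of_adj (hT : T.IsTree) {a b w w' : V}
    (hab : T.Adj a b) (h : T.Adj a w) (h' : T.Adj b w') (hwb : w ≠ b) (hwa : w' ≠ a) :
    ¬ T.Adj w w' := fun hw => by
  have h1 : T.dist a w = 1 := dist_eq_one_iff_adj.2 h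
  have h2 : T.dist a b = 1 := dist_eq_one_iff_adj.2 hab
  have h3 := hT.connected.pos_dist_of_ne hwa.symm
  rcases hT.dist_eq_dist_add_one_of_adj a hw with h4 | h4
  · omega
  · exact hwb (hT.eq_of_adj_of_dist hw h' h4 (by omega))

lemma SimpleGraph.IsTree.nonempty_iso_doubleStar [Finite V] (hT : T.IsTree) {a b : V}
    (hab : T.Adj a b) (hcov : ∀ w, w ≠ a → w ≠ b → T.Adj a w ∨ T.Adj b w) :
    Nonempty (T ≃g doubleStar {w | T.Adj a w ∧ w ≠ b}.ncard {w | T.Adj b w ∧ w ≠ a}.ncard) := by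
  set K : Set V := {w | T.Adj a w ∧ w ≠ b} with hK
  set S : Set V := {w | T.Adj b w ∧ w ≠ a} with hS
  let eK : Fin K.ncard ≃ K := (Finite.equivFin K).symm
  let eS : Fin S.ncard ≃ S := (Finite.equivFin S).symm
  have hdisj : ∀ w, w ∈ K → w ∉ S := fun w hw hw' => hT.not_adj_of_adj_of_adj hab hw.1 hw'.1
  have hKa : ∀ i, T.Adj a (eK i) := fun i => (eK i).2.1
  have hSb : ∀ i, T.Adj b (eS i) := fun i => (eS i).2.1
  have hKb : ∀ i, (eK i : V) ≠ b := fun i => (eK i).2.2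
  have hSa : ∀ i, (eS i : V) ≠ a := fun i => (eS i).2.2
  let f : Fin 2 ⊕ Fin K.ncard ⊕ Fin S.ncard → V
    | .inl c => if c = 0 then a else b
    | .inr (.inl i) => eK i
    | .inr (.inr j) => eS j
  have hKSne : ∀ i j, (eK i : V) ≠ eS j := fun i j h => hdisj _ (eK i).2 (h ▸ (eS j).2)
  have hinj : Function.Injective f := by
    have := hab.ne
    rintro (c | i | j) (c' | i' | j') h
    · fin_cases c <;> fin_cases c'
      · rfl
      · exact absurd h this
      · exact absurd h.symm this
      · rfl
    · fin_cases c
      · exact absurd h (hKa i').ne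
      · exact absurd h.symm (hKb i')
    · fin_cases c
      · exact absurd h.symm (hSa j')
      · exact absurd h (hSb j').ne
    · fin_cases c'
      · exact absurd h.symm (hKa i).ne
      · exact absurd h (hKb i)
    · simpa using eK.injective (Subtype.ext h)
    · exact absurd h (hKSne i j')
    · fin_cases c'
      · exact absurd h (hSa j)
      · exact absurd h.symm (hSb j).ne
    · exact absurd h.symm (hKSne i' j)
    · simpa using eS.injective (Subtype.ext h)
  have hsurj : Function.Surjective f := by
    intro w
    by_cases hwa : w = a
    · exact ⟨.inl 0, by simp [f, hwa]⟩
    by_cases hwb : w = b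
    · exact ⟨.inl 1, by simp [f, hwb]⟩
    rcases hcov w hwa hwb with h | h
    · exact ⟨.inr (.inl (eK.symm ⟨w, h, hwb⟩)), by simp [f]⟩
    · exact ⟨.inr (.inr (eS.symm ⟨w, h, hwa⟩)), by simp [f]⟩
  have hKnb : ∀ i, ¬ T.Adj b (eK i) := fun i h => hdisj _ (eK i).2 ⟨h, (hKa i).ne'⟩
  have hSna : ∀ j, ¬ T.Adj a (eS j) := fun j h => hdisj _ ⟨h, (hSb j).ne'⟩ (eS j).2
  have hadj : ∀ u v, T.Adj (f u) (f v) ↔ (doubleStar K.ncard S.ncard).Adj u v := by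
    have hcl : ∀ c i, T.Adj (f (.inl c)) (eK i) ↔ c = 0 := by
      intro c i
      fin_cases c <;> simp [f, hKa, hKnb]
    have hcr : ∀ c j, T.Adj (f (.inl c)) (eS j) ↔ c = 1 := by
      intro c j
      fin_cases c <;> simp [f, hSb, hSna]
    rintro (c | i | j) (c' | i' | j')
    · fin_cases c <;> fin_cases c' <;> simp [f, hab, hab.symm]
    · simpa using hcl c i'
    · simpa using hcr c j'
    · simpa using (T.adj_comm _ _).trans (hcl c' i)
    · simpa [f] using hT.not_adj_of_adj_of_adj (hKa i) (hKa i')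
    · simpa [f] using hT.not_adj_of_adj_of_adj_of_adj hab (hKa i) (hSb j') (hKb i) (hSa j')
    · simpa using (T.adj_comm _ _).trans (hcr c' j)
    · simpa [f] using fun h : T.Adj (eS j) (eK i') =>
        hT.not_adj_of_adj_of_adj_of_adj hab (hKa i') (hSb j) (hKb i') (hSa j) h.symm
    · simpa [f] using hT.not_adj_of_adj_of_adj (hSb j) (hSb j')
  exact ⟨(RelIso.mk (Equiv.ofBijective f ⟨hinj, hsurj⟩) (fun {u v} => hadj u v) :
    doubleStar K.ncard S.ncard ≃g T).symm⟩

lemma SimpleGraph.IsTree.exists_iso_doubleStar_of_diam_eq_three [Finite V] (hT : T.IsTree)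
    (hd : T.diam = 3) : ∃ k s : ℕ, 1 ≤ k ∧ 1 ≤ s ∧ Nonempty (T ≃g doubleStar k s) := by
  have := hT.connected.nonempty
  have hle : ∀ u v, T.dist u v ≤ 3 := fun u v =>
    hd ▸ dist_le_diam (connected_iff_ediam_ne_top.1 hT.connected)
  obtain ⟨u, v, huv⟩ := T.exists_dist_eq_diam
  rw [hd] at huv
  obtain ⟨p, hp⟩ := hT.connected.exists_walk_length_eq_dist u v
  rw [huv] at hp
  obtain ⟨a, b, hua, hab, hbv⟩ : ∃ a b, T.Adj u a ∧ T.Adj a b ∧ T.Adj b v := by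
    match p, hp with
    | .cons h₁ (.cons h₂ (.cons h₃ .nil)), _ => exact ⟨_, _, h₁, h₂, h₃⟩
  have hub : u ≠ b := by
    rintro rfl
    have := dist_eq_one_iff_adj.2 hbv
    omega
  have hav : a ≠ v := by
    rintro rfl
    have := dist_eq_one_iff_adj.2 hua
    omega
  refine ⟨_, _, ?_, ?_, hT.nonempty_iso_doubleStar hab
    fun w hwa hwb => hT.adj_or_adj_of_dist_le_three hle hua hab hbv hub hav hwa hwb⟩
  · exact (Set.ncard_pos (Set.toFinite _)).2 ⟨u, hua.symm, hub⟩
  · exact (Set.ncard_pos (Set.toFinite _)).2 ⟨v, hbv, hav.symm⟩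

end Trees

/-! ### The shape of eigenvectors for nonzero eigenvalues. -/

section EigenvectorShape

variable {V : Type*} {T : SimpleGraph V} {k s : ℕ}

/-- The vector that is `a`, `b` on the leaves at the first and second centre, and `μ * a`, `μ * b`
on the centres themselves. -/
def doubleStarVec (e : T ≃g doubleStar k s) (μ a b : ℝ) : V → ℝ := fun v =>
  match e v with
  | .inl c => if c = 0 then μ * a else μ * b
  | .inr (.inl _) => a
  | .inr (.inr _) => b

lemma doubleStarVec_zero (e : T ≃g doubleStar k s) (μ : ℝ) : doubleStarVec e μ 0 0 = 0 := by
  ext v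
  simp only [doubleStarVec, mul_zero, ite_self, Pi.zero_apply]
  split <;> rfl

lemma doubleStarVec_ne_zero (e : T ≃g doubleStar k s) {μ a : ℝ} (b : ℝ) (hμ : μ ≠ 0)
    (ha : a ≠ 0) : doubleStarVec e μ a b ≠ 0 := fun h => by
  have := congrFun h (e.symm (.inl 0))
  simp [doubleStarVec, hμ, ha] at this

lemma smul_doubleStarVec (e : T ≃g doubleStar k s) (μ a b c : ℝ) :
    c • doubleStarVec e μ a b = doubleStarVec e μ (c * a) (c * b) := by
  ext v
  simp only [doubleStarVec, Pi.smul_apply, smul_eq_mul]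
  split
  · split <;> ring
  · rfl
  · rfl

/-- Substituting ka = μ²a - μb and sb = μ²b - μa for the leaf sums cancels the contribution of the
centres. -/
lemma doubleStarVec_dotProduct_one [Fintype V] (e : T ≃g doubleStar k s) {μ a b : ℝ}
    (ha : (μ ^ 2 - k) * a = μ * b) (hb : (μ ^ 2 - s) * b = μ * a) :
    doubleStarVec e μ a b ⬝ᵥ (fun _ => (1 : ℝ)) = μ ^ 2 * (a + b) := by
  simp only [dotProduct, mul_one]
  rw [← Equiv.sum_comp e.symm.toEquiv]
  simp [doubleStarVec, Fintype.sum_sum_type]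
  linarith

end EigenvectorShape

/-! ### Eigenvalues, multiplicities and mainness. -/

section Spectrum

lemma SimpleGraph.Iso.sum_neighborFinset_eq {V W : Type*} [Fintype V] [Fintype W]
    {T : SimpleGraph V} {G : SimpleGraph W} [DecidableRel T.Adj] [DecidableRel G.Adj] (e : T ≃g G) (x : V → ℝ) (w : W) :
    ∑ u ∈ T.neighborFinset (e.symm w), x u = ∑ w', if G.Adj w w' then x (e.symm w') else 0 := by
  have h : T.neighborFinset (e.symm w) = Finset.univ.filter (T.Adj (e.symm w)) := by
    ext; simp
  rw [h, Finset.sum_filter]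
  refine (Equiv.sum_comp e.symm.toEquiv _).symm.trans (Finset.sum_congr rfl fun w' _ => ?_)
  exact if_congr e.symm.map_adj_iff rfl rfl

variable {V : Type*} [Fintype V] [DecidableEq V] {T : SimpleGraph V} [DecidableRel T.Adj]
  {k s : ℕ}

lemma mem_eigenspace_iff_of_iso_doubleStar (e : T ≃g doubleStar k s) (μ : ℝ) (x : V → ℝ) :
    x ∈ Module.End.eigenspace (Matrix.toLin' (T.adjMatrix ℝ)) μ ↔
      (x (e.symm (.inl 1)) + ∑ i, x (e.symm (.inr (.inl i))) = μ * x (e.symm (.inl 0)) ∧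
        x (e.symm (.inl 0)) + ∑ j, x (e.symm (.inr (.inr j))) = μ * x (e.symm (.inl 1))) ∧
      (∀ i, x (e.symm (.inl 0)) = μ * x (e.symm (.inr (.inl i)))) ∧
      ∀ j, x (e.symm (.inl 1)) = μ * x (e.symm (.inr (.inr j))) := by
  classical
  rw [Module.End.mem_eigenspace_iff, funext_iff, e.symm.surjective.forall]
  simp only [Matrix.toLin'_apply, adjMatrix_mulVec_apply, e.sum_neighborFinset_eq, Pi.smul_apply,
    smul_eq_mul, Sum.forall, Fin.forall_fin_two, Fintype.sum_sum_type, Fin.sum_univ_two]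
  simp

lemma mem_eigenspace_iff_exists_doubleStarVec (e : T ≃g doubleStar k s) {μ : ℝ} (hμ : μ ≠ 0)
    (x : V → ℝ) :
    x ∈ Module.End.eigenspace (Matrix.toLin' (T.adjMatrix ℝ)) μ ↔
      ∃ a b, x = doubleStarVec e μ a b ∧ (μ ^ 2 - k) * a = μ * b ∧ (μ ^ 2 - s) * b = μ * a := by
  rw [mem_eigenspace_iff_of_iso_doubleStar e]
  constructor
  · rintro ⟨⟨h0, h1⟩, hk, hs⟩
    have hk' : ∀ i, x (e.symm (.inr (.inl i))) = x (e.symm (.inl 0)) / μ := fun i => by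
      rw [hk i]; field_simp
    have hs' : ∀ j, x (e.symm (.inr (.inr j))) = x (e.symm (.inl 1)) / μ := fun j => by
      rw [hs j]; field_simp
    simp only [hk', hs', Finset.sum_const, Finset.card_univ, Fintype.card_fin, nsmul_eq_mul]
      at h0 h1
    refine ⟨x (e.symm (.inl 0)) / μ, x (e.symm (.inl 1)) / μ, ?_, ?_, ?_⟩
    · ext v
      obtain ⟨w, rfl⟩ := e.symm.surjective v
      rcases w with c | i | j
      · fin_cases c
        · simp [doubleStarVec, mul_div_cancel₀ _ hμ]
        · simp [doubleStarVec, mul_div_cancel₀ _ hμ]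
      · simpa [doubleStarVec] using hk' i
      · simpa [doubleStarVec] using hs' j
    · field_simp at h0 ⊢
      linarith
    · field_simp at h1 ⊢
      linarith
  · rintro ⟨a, b, rfl, h0, h1⟩
    simp only [doubleStarVec, RelIso.apply_symm_apply, Finset.sum_const, Finset.card_univ,
      Fintype.card_fin, nsmul_eq_mul]
    simp
    constructor <;> linarith

/-- The eigenvectors of a double star for nonzero eigenvalues. -/
lemma hasEigenvector_iff_exists_doubleStarVec (e : T ≃g doubleStar k s) {μ : ℝ} (hμ : μ ≠ 0)
    (x : V → ℝ) :
    Module.End.HasEigenvector (Matrix.toLin' (T.adjMatrix ℝ)) μ x ↔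
      ∃ a b, a ≠ 0 ∧ x = doubleStarVec e μ a b ∧ (μ ^ 2 - k) * a = μ * b ∧
        (μ ^ 2 - s) * b = μ * a := by
  rw [Module.End.hasEigenvector_iff, mem_eigenspace_iff_exists_doubleStarVec e hμ]
  constructor
  · rintro ⟨⟨a, b, rfl, ha, hb⟩, hx⟩
    refine ⟨a, b, ?_, rfl, ha, hb⟩
    rintro rfl
    have hb0 : b = 0 := by simpa [hμ] using ha.symm
    exact hx (hb0 ▸ doubleStarVec_zero e μ)
  · rintro ⟨a, b, h0, rfl, ha, hb⟩
    exact ⟨⟨a, b, rfl, ha, hb⟩, doubleStarVec_ne_zero e b hμ h0⟩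

lemma isGraphEigenvalue_iff_of_iso_doubleStar (e : T ≃g doubleStar k s) {μ : ℝ} (hμ : μ ≠ 0) :
    IsGraphEigenvalue T μ ↔ (μ ^ 2 - k) * (μ ^ 2 - s) = μ ^ 2 := by
  constructor
  · intro h
    obtain ⟨x, hx⟩ := Module.End.HasEigenvalue.exists_hasEigenvector h
    obtain ⟨a, b, h0, -, ha, hb⟩ := (hasEigenvector_iff_exists_doubleStarVec e hμ x).1 hx
    refine mul_right_cancel₀ h0 ?_
    linear_combination (μ ^ 2 - s) * ha + μ * hb
  · intro h
    -- Taking a = μ, the first equation gives b = μ² - k; the second is then the hypothesis.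
    refine Module.End.hasEigenvalue_of_hasEigenvector (x := doubleStarVec e μ μ (μ ^ 2 - k)) ?_
    exact (hasEigenvector_iff_exists_doubleStarVec e hμ _).2
      ⟨μ, μ ^ 2 - k, hμ, rfl, by ring, by linarith⟩

lemma isMainEigenvalue_of_iso_doubleStar_of_ne (e : T ≃g doubleStar k s) (hks : k ≠ s) {μ : ℝ}
    (hμ : μ ≠ 0) (h : IsGraphEigenvalue T μ) : IsMainEigenvalue T μ := by
  obtain ⟨x, hx⟩ := Module.End.HasEigenvalue.exists_hasEigenvector h
  refine ⟨x, hx, ?_⟩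
  obtain ⟨a, b, h0, rfl, ha, hb⟩ := (hasEigenvector_iff_exists_doubleStarVec e hμ x).1 hx
  rw [doubleStarVec_dotProduct_one e ha hb]
  refine mul_ne_zero (pow_ne_zero 2 hμ) fun hab => hks ?_
  obtain rfl : b = -a := by linarith
  have : (k : ℝ) * a = s * a := by linarith
  exact_mod_cast mul_right_cancel₀ h0 this

lemma not_isMainEigenvalue_of_sq_sub_eq_neg (e : T ≃g doubleStar k s) {μ : ℝ} (hμ : μ ≠ 0)
    (h : μ ^ 2 - k = -μ) : ¬ IsMainEigenvalue T μ := by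
  rintro ⟨x, hx, hx1⟩
  obtain ⟨a, b, h0, rfl, ha, hb⟩ := (hasEigenvector_iff_exists_doubleStarVec e hμ x).1 hx
  rw [doubleStarVec_dotProduct_one e ha hb] at hx1
  rw [h] at ha
  have : b = -a := mul_left_cancel₀ hμ (by linarith)
  exact hx1 (by rw [this]; ring)

lemma finrank_eigenspace_of_iso_doubleStar (e : T ≃g doubleStar k s) {μ : ℝ} (hμ : μ ≠ 0)
    (h : IsGraphEigenvalue T μ) :
    Module.finrank ℝ (Module.End.eigenspace (Matrix.toLin' (T.adjMatrix ℝ)) μ) = 1 := by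
  have h' := (isGraphEigenvalue_iff_of_iso_doubleStar e hμ).1 h
  refine finrank_eq_one_iff'.2 ⟨⟨doubleStarVec e μ μ (μ ^ 2 - k),
    (mem_eigenspace_iff_exists_doubleStarVec e hμ _).2
      ⟨μ, μ ^ 2 - k, rfl, by ring, by linarith⟩⟩, ?_, ?_⟩
  · intro h0
    exact doubleStarVec_ne_zero e _ hμ hμ (congrArg Subtype.val h0)
  · rintro ⟨w, hw⟩
    obtain ⟨a, b, rfl, ha, -⟩ := (mem_eigenspace_iff_exists_doubleStarVec e hμ w).1 hw
    refine ⟨a / μ, Subtype.ext ?_⟩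
    change (a / μ) • doubleStarVec e μ μ (μ ^ 2 - k) = _
    rw [smul_doubleStarVec]
    congr 1
    · field_simp
    · field_simp
      linarith

/-- The discriminant is (k - s)² + 2(k + s) + 1 > 0, and the smaller root is positive because the
product of the roots is ks > 0. -/
lemma exists_roots_doubleStar (hk : 1 ≤ k) (hs : 1 ≤ s) :
    ∃ t₁ t₂ : ℝ, 0 < t₂ ∧ t₂ < t₁ ∧ ∀ t : ℝ, (t - k) * (t - s) - t = (t - t₁) * (t - t₂) := by
  have hk' : (1 : ℝ) ≤ k := by exact_mod_cast hk
  have hs' : (1 : ℝ) ≤ s := by exact_mod_cast hs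
  set D : ℝ := (k + s + 1) ^ 2 - 4 * (k * s) with hD
  have hD0 : 0 < D := by nlinarith [sq_nonneg ((k : ℝ) - s)]
  have hr := Real.sq_sqrt hD0.le
  have hr0 := Real.sqrt_pos.2 hD0
  refine ⟨(k + s + 1 + √D) / 2, (k + s + 1 - √D) / 2, ?_, by linarith, fun t => ?_⟩
  · have : √D < k + s + 1 := by
      rw [Real.sqrt_lt' (by positivity)]
      have : (0 : ℝ) < k * s := by positivity
      linarith
    linarith
  · linear_combination hr / 4 + hD / 4

lemma setOf_eigenvalues_ne_zero_of_iso_doubleStar (e : T ≃g doubleStar k s) {t₁ t₂ : ℝ}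
    (h₂ : 0 < t₂) (h₁₂ : t₂ < t₁)
    (ht : ∀ t : ℝ, (t - k) * (t - s) - t = (t - t₁) * (t - t₂)) :
    {μ : ℝ | IsGraphEigenvalue T μ ∧ μ ≠ 0} = {√t₁, -√t₁, √t₂, -√t₂} := by
  have h₁ : 0 < t₁ := h₂.trans h₁₂
  have hs₁ := Real.sqrt_pos.2 h₁
  have hs₂ := Real.sqrt_pos.2 h₂
  have key : ∀ μ : ℝ, μ ≠ 0 → (IsGraphEigenvalue T μ ↔ μ ^ 2 = √t₁ ^ 2 ∨ μ ^ 2 = √t₂ ^ 2) := by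
    intro μ hμ
    rw [isGraphEigenvalue_iff_of_iso_doubleStar e hμ, ← sub_eq_zero, ht, mul_eq_zero, sub_eq_zero,
      sub_eq_zero, Real.sq_sqrt h₁.le, Real.sq_sqrt h₂.le]
  ext μ
  simp only [Set.mem_ofPred_eq, Set.mem_insert_iff, Set.mem_singleton_iff]
  constructor
  · rintro ⟨h, hμ⟩
    have := (key μ hμ).1 h
    rw [sq_eq_sq_iff_eq_or_eq_neg, sq_eq_sq_iff_eq_or_eq_neg] at this
    tauto
  · intro h
    have hμ : μ ≠ 0 := by
      rcases h with rfl | rfl | rfl | rfl <;> simp [hs₁.ne', hs₂.ne']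
    refine ⟨(key μ hμ).2 ?_, hμ⟩
    rw [sq_eq_sq_iff_eq_or_eq_neg, sq_eq_sq_iff_eq_or_eq_neg]
    tauto

lemma ncard_sqrt_four {t₁ t₂ : ℝ} (h₂ : 0 < t₂) (h₁₂ : t₂ < t₁) :
    ({√t₁, -√t₁, √t₂, -√t₂} : Set ℝ).ncard = 4 := by
  have hs₂ := Real.sqrt_pos.2 h₂
  have hs₁₂ := Real.sqrt_lt_sqrt h₂.le h₁₂
  rw [Set.ncard_insert_of_notMem, Set.ncard_insert_of_notMem, Set.ncard_pair]
  · linarith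
  · simp only [Set.mem_insert_iff, Set.mem_singleton_iff, not_or]
    constructor <;> intro h <;> linarith
  · simp only [Set.mem_insert_iff, Set.mem_singleton_iff, not_or]
    refine ⟨?_, ?_, ?_⟩ <;> intro h <;> linarith

lemma exists_isLeast_eigenvalue_of_iso_doubleStar (e : T ≃g doubleStar k s) (hk : 1 ≤ k)
    (hs : 1 ≤ s) :
    ∃ lam : ℝ, IsLeast {μ : ℝ | IsGraphEigenvalue T μ} lam ∧
      (IsNonMainEigenvalue T lam ↔ k = s) := by
  obtain ⟨t₁, t₂, h₂, h₁₂, ht⟩ := exists_roots_doubleStar hk hs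
  have hset := setOf_eigenvalues_ne_zero_of_iso_doubleStar e h₂ h₁₂ ht
  have h₁ : 0 < t₁ := h₂.trans h₁₂
  have hs₁ := Real.sqrt_pos.2 h₁
  have hs₂ := Real.sqrt_pos.2 h₂
  have hs₁₂ := Real.sqrt_lt_sqrt h₂.le h₁₂
  obtain ⟨hev, hne⟩ : IsGraphEigenvalue T (-√t₁) ∧ -√t₁ ≠ 0 := by
    change -√t₁ ∈ {μ : ℝ | IsGraphEigenvalue T μ ∧ μ ≠ 0}
    simp [hset]
  refine ⟨-√t₁, ⟨hev, fun μ hμ => ?_⟩, ?_⟩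
  -- Whether or not 0 is an eigenvalue, it exceeds -√t₁.
  · by_cases h0 : μ = 0
    · linarith
    · have : μ ∈ ({√t₁, -√t₁, √t₂, -√t₂} : Set ℝ) := hset ▸ ⟨hμ, h0⟩
      rcases this with rfl | rfl | rfl | rfl <;> linarith
  · constructor
    · intro h
      by_contra hks
      exact h.2 (isMainEigenvalue_of_iso_doubleStar_of_ne e hks hne hev)
    · rintro rfl
      refine ⟨hev, not_isMainEigenvalue_of_sq_sub_eq_neg e hne ?_⟩
      have hk' : (1 : ℝ) ≤ k := by exact_mod_cast hk
      -- At t = k the quadratic equals -k < 0, so k lies below the larger root. This picks the sign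
      -- t₁ - k = √t₁ in (t₁ - k)² = t₁.
      have hkt : (k : ℝ) < t₁ := by
        have := ht k
        by_contra! hle
        nlinarith [mul_nonneg (sub_nonneg.2 hle) (sub_nonneg.2 (h₁₂.le.trans hle))]
      have hsq := Real.sq_sqrt h₁.le
      have h3 : (t₁ - k) ^ 2 = √t₁ ^ 2 := by
        have := ht t₁
        rw [hsq]
        linarith
      have h4 := (sq_eq_sq₀ (by linarith) hs₁.le).1 h3
      rw [neg_sq, hsq, neg_neg, h4]

end Spectrum

theorem theorem4p5 {V : Type*} [Fintype V] [DecidableEq V] (T : SimpleGraph V)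
    [DecidableRel T.Adj] :
    -- the trees of diameter three are exactly the graphs `T(k,s)` with `k, s ≥ 1`
    ((T.IsTree ∧ T.diam = 3) ↔
      ∃ k s : ℕ, 1 ≤ k ∧ 1 ≤ s ∧ Nonempty (T ≃g doubleStar k s)) ∧
    ∀ k s : ℕ, 1 ≤ k → 1 ≤ s → Nonempty (T ≃g doubleStar k s) →
      -- the least eigenvalue is non-main if and only if `T` is balanced
      (∃ lam : ℝ, IsLeast {μ : ℝ | IsGraphEigenvalue T μ} lam ∧
        (IsNonMainEigenvalue T lam ↔ k = s)) ∧
      -- if `T` is not balanced, its four nonzero eigenvalues (distinct, simple) are all main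
      (k ≠ s →
        {μ : ℝ | IsGraphEigenvalue T μ ∧ μ ≠ 0}.ncard = 4 ∧
        ∀ μ : ℝ, IsGraphEigenvalue T μ → μ ≠ 0 →
          Module.finrank ℝ (Module.End.eigenspace (Matrix.toLin' (T.adjMatrix ℝ)) μ) = 1 ∧
          IsMainEigenvalue T μ) := by
  refine ⟨⟨fun h => h.1.exists_iso_doubleStar_of_diam_eq_three h.2, ?_⟩, ?_⟩
  · rintro ⟨k, s, hk, hs, ⟨e⟩⟩
    exact isTree_and_diam_eq_three_of_iso hk hs e
  · rintro k s hk hs ⟨e⟩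
    refine ⟨exists_isLeast_eigenvalue_of_iso_doubleStar e hk hs, fun hks => ⟨?_, ?_⟩⟩
    · obtain ⟨t₁, t₂, h₂, h₁₂, ht⟩ := exists_roots_doubleStar hk hs
      rw [setOf_eigenvalues_ne_zero_of_iso_doubleStar e h₂ h₁₂ ht, ncard_sqrt_four h₂ h₁₂]
    · exact fun μ hμ h0 => ⟨finrank_eigenspace_of_iso_doubleStar e h0 hμ,
        isMainEigenvalue_of_iso_doubleStar_of_ne e hks h0 hμ⟩
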